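/- Let $G$ be a finite group and let $e$ be a primitive central idempotent of the rational group algebra $\mathbb{Q}G$. If the simple component $\mathbb{Q}Ge$ is isomorphic, as a ring, to the matrix ring $M_2(K)$ for an imaginary quadratic field $K$, then $K$ is isomorphic to $\mathbb{Q}(\sqrt{-d})$ for some $d\in\{1,2,3\}$; in particular, the component $\mathbb{Q}Ge$ is isomorphic to $M_2(\mathbb{Q}(\sqrt{-1}))$, $M_2(\mathbb{Q}(\sqrt{-2}))$ or $M_2(\mathbb{Q}(\sqrt{-3}))$. Moreover, let $K$ be an imaginary quadratic field (in particular, one of the fields $\mathbb{Q}(\sqrt{-1})$, $\mathbb{Q}(\sqrt{-2})$, $\mathbb{Q}(\sqrt{-3})$). Then every finite subgroup of $\mathrm{GL}_2(K)$ is solvable and has order $2^a3^b$ for some integers $a,b\ge 0$. -/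

import Mathlib

open scoped MatrixGroups

/-- A primitive central idempotent of a ring: a nonzero central idempotent that is not the sum of
two nonzero orthogonal central idempotents. -/
structure IsPrimitiveCentralIdempotent {R : Type*} [Ring R] (e : R) : Prop where
  isIdempotentElem : IsIdempotentElem e
  mem_center : e ∈ Subring.center R
  ne_zero : e ≠ 0
  primitive : ∀ f g : R, f ∈ Subring.center R → g ∈ Subring.center R →
    IsIdempotentElem f → IsIdempotentElem g → f * g = 0 → f + g = e → f = 0 ∨ g = 0

/-- The simple component `ℚG e` of the rational group algebra `ℚG` that belongs to a primitive
central idempotent `e`: the ring of all elements `e * x * e = x * e`, with identity element `e`. -/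
abbrev SimpleComponent {G : Type*} [Group G] {e : MonoidAlgebra ℚ G}
    (he : IsPrimitiveCentralIdempotent e) : Type _ :=
  he.isIdempotentElem.Corner

/-- An imaginary quadratic field: an extension of `ℚ` of degree two without real embeddings. -/
def IsImaginaryQuadratic (K : Type*) [Field K] [NumberField K] : Prop :=
  Module.finrank ℚ K = 2 ∧ NumberField.IsTotallyComplex K

/-- The field `ℚ(√(-d))`, as the subfield of `ℂ` generated by `√d * i`. -/
noncomputable abbrev RatSqrtNeg (d : ℕ) : IntermediateField ℚ ℂ :=
  IntermediateField.adjoin ℚ {((Real.sqrt (d : ℝ) : ℝ) : ℂ) * Complex.I}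

/-! A finite-order matrix of determinant one has eigenvalues z and z⁻¹ with z a root of unity. Its
trace is an algebraic integer with real image, and such elements of K are rational, so the trace is
an integer in [-2, 2] and the order divides 12. Roots of unity in K obey the same bound, so only the
primes 2 and 3 divide the order of a finite subgroup. For solvability, a trace count shows that
3-subgroups of SL₂ have at most three elements; in the kernel of the determinant a Sylow 2-subgroup
then has index at most 3, and the action on its cosets finishes the argument.

For the field, G spans ℚG, which maps onto M₂(K), so some g has irrational trace. Its determinant is
not 1. If it is -1, the squared trace is tr(A²) - 2, one of -4, ..., -1; otherwise it is a root of
unity of order 3, 4 or 6. Either way K contains √-1, √-2 or √-3. -/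

/-! ### Roots of unity and matrices of finite order -/

/-- In a totally complex quadratic field, an element with real image in `ℂ` is rational. -/
theorem IsImaginaryQuadratic.exists_rat_of_conj_eq {K : Type*} [Field K] [NumberField K]
    (hK : IsImaginaryQuadratic K) (σ : K →ₐ[ℚ] ℂ) {t : K}
    (ht : (starRingEnd ℂ) (σ t) = σ t) : ∃ q : ℚ, t = algebraMap ℚ K q := by
  have : IsSimpleOrder (IntermediateField ℚ K) :=
    IntermediateField.isSimpleOrder_of_finrank_prime ℚ K (by rw [hK.1]; exact Nat.prime_two)
  rcases eq_bot_or_eq_top (IntermediateField.adjoin ℚ {t}) with h | h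
  · obtain ⟨q, hq⟩ := IntermediateField.mem_bot.1 (IntermediateField.adjoin_simple_eq_bot_iff.1 h)
    exact ⟨q, hq.symm⟩
  -- Here t generates K, so σ would be real on all of K.
  · exfalso
    have := hK.2
    refine NumberField.IsTotallyComplex.complexEmbedding_not_isReal (σ : K →+* ℂ) ?_
    rw [NumberField.ComplexEmbedding.isReal_iff]
    ext x
    have hx : x ∈ IntermediateField.adjoin ℚ {t} := h ▸ IntermediateField.mem_top
    change (starRingEnd ℂ) (σ x) = σ x
    induction hx using IntermediateField.adjoin_induction with
    | mem y hy => rwa [Set.mem_singleton_iff.1 hy]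
    | algebraMap q => simp
    | add y z _ _ hy hz => rw [map_add, map_add, hy, hz]
    | inv y _ hy => rw [map_inv₀, map_inv₀, hy]
    | mul y z _ _ hy hz => rw [map_mul, map_mul, hy, hz]

/-- An element of an imaginary quadratic field whose image in `ℂ` is a sum `z + z⁻¹` with `z` a root of unity is an integer
of absolute value at most two. -/
theorem IsImaginaryQuadratic.exists_int_of_add_inv {K : Type*} [Field K] [NumberField K]
    (hK : IsImaginaryQuadratic K) (σ : K →ₐ[ℚ] ℂ) {t : K} {z : ℂ} {n : ℕ} (hn : n ≠ 0)
    (hz : z ^ n = 1) (ht : σ t = z + z⁻¹) : ∃ m : ℤ, t = m ∧ -2 ≤ m ∧ m ≤ 2 := by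
  have hnorm := Complex.norm_eq_one_of_pow_eq_one hz hn
  have hinv := Complex.inv_eq_conj hnorm
  obtain ⟨q, rfl⟩ := hK.exists_rat_of_conj_eq σ (t := t) (by
    rw [ht, hinv, map_add, Complex.conj_conj, add_comm])
  rw [AlgHom.commutes] at ht
  have hz' : IsIntegral ℤ z := ⟨Polynomial.X ^ n - 1, Polynomial.monic_X_pow_sub_C 1 hn, by
    simp [hz]⟩
  have hzi : IsIntegral ℤ z⁻¹ := ⟨Polynomial.X ^ n - 1, Polynomial.monic_X_pow_sub_C 1 hn, by
    simp [hz]⟩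
  have hq : IsIntegral ℤ q := by
    rw [← isIntegral_algebraMap_iff (algebraMap ℚ ℂ).injective, ht]
    exact hz'.add hzi
  obtain ⟨m, rfl⟩ := IsIntegrallyClosed.isIntegral_iff.1 hq
  refine ⟨m, by simp, ?_⟩
  have h2 : ‖((m : ℝ) : ℂ)‖ ≤ 2 := by
    have : ((m : ℝ) : ℂ) = z + z⁻¹ := by rw [← ht]; simp
    rw [this]
    refine (norm_add_le _ _).trans ?_
    rw [norm_inv, hnorm]; norm_num
  rw [Complex.norm_real, Real.norm_eq_abs, abs_le] at h2
  exact ⟨by exact_mod_cast h2.1, by exact_mod_cast h2.2⟩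

/-- A root of unity in an imaginary quadratic field is a root of `X ^ 2 - m * X + 1` with
`|m| ≤ 2`. -/
theorem IsImaginaryQuadratic.exists_int_of_pow_eq_one {K : Type*} [Field K] [NumberField K]
    (hK : IsImaginaryQuadratic K) {z : K} {n : ℕ} (hn : n ≠ 0) (hz : z ^ n = 1) :
    ∃ m : ℤ, z ^ 2 - m * z + 1 = 0 ∧ -2 ≤ m ∧ m ≤ 2 := by
  let σ : K →ₐ[ℚ] ℂ := IsAlgClosed.lift
  obtain ⟨m, hm, h⟩ := hK.exists_int_of_add_inv σ (t := z + z⁻¹) (z := σ z) hn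
    (by rw [← map_pow, hz, map_one]) (by simp)
  have hz0 : z ≠ 0 := by rintro rfl; simp [hn] at hz
  refine ⟨m, ?_, h⟩
  rw [← hm]; field_simp; ring

theorem Matrix.sq_fin_two {R : Type*} [CommRing R] (A : Matrix (Fin 2) (Fin 2) R) :
    A ^ 2 = A.trace • A - A.det • (1 : Matrix (Fin 2) (Fin 2) R) := by
  ext i j
  fin_cases i <;> fin_cases j <;>
    simp [pow_two, Matrix.mul_apply, Matrix.trace_fin_two, Matrix.det_fin_two] <;> ring

theorem Matrix.exists_eigenvalue_fin_two {F : Type*} [Field F] [IsAlgClosed F]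
    (A : Matrix (Fin 2) (Fin 2) F) {n : ℕ} (hA : A ^ n = 1) (hdet : A.det = 1) :
    ∃ z : F, z ^ n = 1 ∧ A.trace = z + z⁻¹ := by
  have hdeg : (A.charpoly).degree ≠ 0 := by
    rw [Matrix.charpoly_degree_eq_dim]; simp
  obtain ⟨z, hz⟩ := IsAlgClosed.exists_root A.charpoly hdeg
  have hz2 : z ^ 2 - A.trace * z + 1 = 0 := by
    rw [Matrix.charpoly_fin_two, hdet] at hz
    simpa [Polynomial.IsRoot] using hz
  have hz0 : z ≠ 0 := by rintro rfl; simp at hz2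
  refine ⟨z, ?_, ?_⟩
  · have hev : Module.End.HasEigenvalue (Matrix.toLin' A) z := by
      rw [Module.End.hasEigenvalue_iff_isRoot_charpoly, Matrix.charpoly_toLin']
      exact hz
    obtain ⟨v, hv⟩ := hev.exists_hasEigenvector
    have h := hv.pow_apply n
    rw [← Matrix.toLin'_pow, hA, Matrix.toLin'_one, LinearMap.id_apply] at h
    have h' : (z ^ n - 1) • v = 0 := by rw [sub_smul, ← h, one_smul, sub_self]
    rcases smul_eq_zero.1 h' with h' | h'
    · exact sub_eq_zero.1 h'
    · exact absurd h' hv.2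
  · field_simp
    linear_combination -hz2

/-- Elements of finite order of `SL₂` over an imaginary quadratic field have integral trace of
absolute value at most two. -/
theorem IsImaginaryQuadratic.exists_int_trace {K : Type*} [Field K] [NumberField K]
    (hK : IsImaginaryQuadratic K) {A : Matrix (Fin 2) (Fin 2) K} {n : ℕ} (hn : n ≠ 0)
    (hA : A ^ n = 1) (hdet : A.det = 1) : ∃ m : ℤ, A.trace = m ∧ -2 ≤ m ∧ m ≤ 2 := by
  let σ : K →ₐ[ℚ] ℂ := IsAlgClosed.lift
  obtain ⟨z, hz, ht⟩ := Matrix.exists_eigenvalue_fin_two (σ.mapMatrix A) (n := n)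
    (by rw [← map_pow, hA, map_one]) (by rw [← AlgHom.map_det, hdet, map_one])
  refine hK.exists_int_of_add_inv σ hn hz ?_
  rw [← ht, Matrix.trace_fin_two, Matrix.trace_fin_two]
  simp

/-- By Cayley–Hamilton `A - 1` squares to zero, so `A ^ n = 1 + n (A - 1)`, and n is invertible in
characteristic zero. -/
theorem Matrix.eq_one_of_pow_eq_one_of_trace_eq_two {F : Type*} [Field F] [CharZero F]
    {A : Matrix (Fin 2) (Fin 2) F} {n : ℕ} (hn : n ≠ 0) (hA : A ^ n = 1) (hdet : A.det = 1)
    (htr : A.trace = 2) : A = 1 := by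
  have h2 := Matrix.sq_fin_two A
  rw [hdet, htr, one_smul, two_smul] at h2
  have key : ∀ k : ℕ, A ^ k = 1 + (k : F) • (A - 1) := by
    intro k
    induction k with
    | zero => simp
    | succ k ih =>
      rw [pow_succ, ih, add_mul, one_mul, smul_mul_assoc, sub_mul, one_mul, ← pow_two, h2]
      push_cast
      rw [add_smul, one_smul, show A + A - 1 - A = A - 1 by abel]
      abel
  have h := key n
  rw [hA, left_eq_add, smul_eq_zero] at h
  rcases h with h | h
  · exact absurd (Nat.cast_eq_zero.1 h) hn
  · exact sub_eq_zero.1 h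

/-- Elements of finite order of `SL₂` over an imaginary quadratic field have order dividing `12`. -/
theorem IsImaginaryQuadratic.pow_twelve_eq_one {K : Type*} [Field K] [NumberField K]
    (hK : IsImaginaryQuadratic K) {A : Matrix (Fin 2) (Fin 2) K} {n : ℕ} (hn : n ≠ 0)
    (hA : A ^ n = 1) (hdet : A.det = 1) : A ^ 12 = 1 := by
  obtain ⟨m, hm, h1, h2⟩ := hK.exists_int_trace hn hA hdet
  have hsq := Matrix.sq_fin_two A
  rw [hdet, hm, one_smul] at hsq
  -- For m = -1, 0, 1 the characteristic polynomial is cyclotomic (Φ₃, Φ₄, Φ₆); for m = ±2 one of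
  -- `A`, `-A` is unipotent.
  obtain rfl | rfl | rfl | rfl | rfl : m = -2 ∨ m = -1 ∨ m = 0 ∨ m = 1 ∨ m = 2 := by omega
  · have : -A = 1 := by
      refine Matrix.eq_one_of_pow_eq_one_of_trace_eq_two (n := 2 * n) (by omega) ?_ ?_ ?_
      · rw [pow_mul, neg_sq, ← pow_mul, mul_comm, pow_mul, hA, one_pow]
      · simp [Matrix.det_neg, hdet]
      · rw [Matrix.trace_neg, hm]; simp
    rw [show (12 : ℕ) = 2 * 6 from rfl, pow_mul, ← neg_sq, this, one_pow, one_pow]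
  · have h3 : A ^ 3 = 1 := by
      rw [pow_succ, hsq]; simp only [Int.cast_neg, Int.cast_one, neg_smul, one_smul]
      rw [sub_mul, neg_mul, ← pow_two, hsq]; simp
    rw [show (12 : ℕ) = 3 * 4 from rfl, pow_mul, h3, one_pow]
  · have h4 : A ^ 4 = 1 := by
      rw [show (4 : ℕ) = 2 * 2 from rfl, pow_mul, hsq]; simp
    rw [show (12 : ℕ) = 4 * 3 from rfl, pow_mul, h4, one_pow]
  · have h3 : A ^ 3 = -1 := by
      rw [pow_succ, hsq]; simp only [Int.cast_one, one_smul]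
      rw [sub_mul, ← pow_two, hsq]; simp
    rw [show (12 : ℕ) = 3 * 4 from rfl, pow_mul, h3]; simp [Even.neg_pow (by decide : Even 4)]
  · rw [Matrix.eq_one_of_pow_eq_one_of_trace_eq_two hn hA hdet (by rw [hm]; simp), one_pow]

theorem IsImaginaryQuadratic.root_of_unity_pow_twelve {K : Type*} [Field K] [NumberField K]
    (hK : IsImaginaryQuadratic K) {z : K} {n : ℕ} (hn : n ≠ 0) (hz : z ^ n = 1) : z ^ 12 = 1 := by
  obtain ⟨m, hm, h1, h2⟩ := hK.exists_int_of_pow_eq_one hn hz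
  obtain rfl | rfl | rfl | rfl | rfl : m = -2 ∨ m = -1 ∨ m = 0 ∨ m = 1 ∨ m = 2 := by omega
  all_goals push_cast at hm
  · have : z = -1 := by
      have : (z + 1) ^ 2 = 0 := by linear_combination hm
      exact eq_neg_of_add_eq_zero_left (pow_eq_zero_iff two_ne_zero |>.1 this)
    rw [this]; norm_num
  · have : z ^ 3 = 1 := by linear_combination (z - 1) * hm
    rw [show (12 : ℕ) = 3 * 4 from rfl, pow_mul, this, one_pow]
  · have : z ^ 2 = -1 := by linear_combination hm
    rw [show (12 : ℕ) = 2 * 6 from rfl, pow_mul, this]; norm_num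
  · have : z ^ 3 = -1 := by linear_combination (z + 1) * hm
    rw [show (12 : ℕ) = 3 * 4 from rfl, pow_mul, this]; norm_num
  · have : z = 1 := by
      have : (z - 1) ^ 2 = 0 := by linear_combination hm
      exact sub_eq_zero.1 (pow_eq_zero_iff two_ne_zero |>.1 this)
    rw [this]; norm_num

/-- One twelfth power makes the determinant 1, a second one gives the identity. -/
theorem IsImaginaryQuadratic.matrix_pow_eq_one {K : Type*} [Field K] [NumberField K]
    (hK : IsImaginaryQuadratic K) {A : Matrix (Fin 2) (Fin 2) K} {n : ℕ} (hn : n ≠ 0)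
    (hA : A ^ n = 1) : A ^ 144 = 1 := by
  rw [show (144 : ℕ) = 12 * 12 from rfl, pow_mul]
  refine hK.pow_twelve_eq_one hn (by rw [← pow_mul, mul_comm, pow_mul, hA, one_pow]) ?_
  rw [Matrix.det_pow]
  exact hK.root_of_unity_pow_twelve hn (by rw [← Matrix.det_pow, hA, Matrix.det_one])

/-! ### Orders and solvability of finite subgroups -/

theorem Nat.exists_eq_two_pow_mul_three_pow {n : ℕ} (hn : n ≠ 0)
    (h : ∀ p, p.Prime → p ∣ n → p = 2 ∨ p = 3) : ∃ a b : ℕ, n = 2 ^ a * 3 ^ b := by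
  induction n using Nat.strong_induction_on with
  | _ n ih =>
    by_cases h1 : n = 1
    · exact ⟨0, 0, by simpa using h1⟩
    obtain ⟨p, hp, k, rfl⟩ := Nat.exists_prime_and_dvd h1
    have hk : k ≠ 0 := by rintro rfl; simp at hn
    obtain ⟨a, b, rfl⟩ := ih k (lt_mul_of_one_lt_left (Nat.pos_of_ne_zero hk) hp.one_lt) hk
      fun q hq hqk => h q hq (hqk.mul_left p)
    rcases h p hp (dvd_mul_right _ _) with rfl | rfl
    · exact ⟨a + 1, b, by ring⟩
    · exact ⟨a, b + 1, by ring⟩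

/-- A finite group with a `p`-subgroup of index at most three is solvable. -/
theorem IsPGroup.isSolvable_of_index_le_three {G : Type*} [Group G] [Finite G] {p : ℕ}
    [Fact p.Prime] {P : Subgroup G} (hP : IsPGroup p P) (h : P.index ≤ 3) :
    Group.IsSolvable G := by
  have hker : IsPGroup p (MulAction.toPermHom G (G ⧸ P)).ker := by
    rw [← Subgroup.normalCore_eq_ker]
    exact hP.to_le P.normalCore_le
  have := hker.isNilpotent
  have hcard : Nat.card (Equiv.Perm (G ⧸ P)) = (P.index).factorial := Nat.card_perm
  have hpos : P.index ≠ 0 := Subgroup.index_ne_zero_of_finite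
  -- The image lies in a symmetric group of order 1, 2 or 6; groups of squarefree order have cyclic
  -- Sylow subgroups and are solvable.
  have hsq : Squarefree (Nat.card (Equiv.Perm (G ⧸ P))) := by
    rw [hcard]
    obtain h | h | h : P.index = 1 ∨ P.index = 2 ∨ P.index = 3 := by omega
    · rw [h]; exact squarefree_one
    · rw [h]; exact Nat.prime_two.squarefree
    · rw [h]
      exact (Nat.squarefree_mul (by decide : Nat.Coprime 3 2)).2
        ⟨Nat.prime_three.squarefree, Nat.prime_two.squarefree⟩
  have : IsZGroup (Equiv.Perm (G ⧸ P)) := IsZGroup.of_squarefree hsq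
  exact Group.isSolvable_of_ker_le_range (MulAction.toPermHom G (G ⧸ P)).ker.subtype
    (MulAction.toPermHom G (G ⧸ P)) (by simp)

/-- The index of a Sylow 2-subgroup is the order of a Sylow 3-subgroup. -/
theorem Group.isSolvable_of_card_subgroup_le_three {G : Type*} [Group G] [Finite G] {a b : ℕ}
    (hcard : Nat.card G = 2 ^ a * 3 ^ b)
    (h : ∀ P : Subgroup G, IsPGroup 3 P → Nat.card P ≤ 3) : Group.IsSolvable G := by
  have h3 := h (default : Sylow 3 G) (default : Sylow 3 G).isPGroup'
  have hb : (Nat.card G).factorization 3 = b := by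
    rw [hcard, Nat.factorization_mul (by positivity) (by positivity),
      Nat.Prime.factorization_pow Nat.prime_two, Nat.Prime.factorization_pow Nat.prime_three]
    simp
  have ha : (Nat.card G).factorization 2 = a := by
    rw [hcard, Nat.factorization_mul (by positivity) (by positivity),
      Nat.Prime.factorization_pow Nat.prime_two, Nat.Prime.factorization_pow Nat.prime_three]
    simp
  rw [Sylow.card_eq_multiplicity, hb] at h3
  have h2 := Subgroup.index_mul_card (default : Sylow 2 G).toSubgroup
  rw [Sylow.card_eq_multiplicity, ha, hcard, mul_comm] at h2
  refine (default : Sylow 2 G).isPGroup'.isSolvable_of_index_le_three ?_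
  rwa [Nat.eq_of_mul_eq_mul_left (by positivity) h2]

/-- A finite `3`-subgroup of `SL₂` over an imaginary quadratic field has at most three elements. -/
theorem IsImaginaryQuadratic.card_le_three {K : Type*} [Field K] [NumberField K]
    (hK : IsImaginaryQuadratic K) {P : Type*} [Group P] [Finite P] (hP : IsPGroup 3 P)
    (f : P →* Matrix (Fin 2) (Fin 2) K) (hf : Function.Injective f)
    (hdet : ∀ x, (f x).det = 1) : Nat.card P ≤ 3 := by
  have hcube : ∀ x : P, x ^ 3 = 1 := by
    intro x
    obtain ⟨k, hk⟩ := hP x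
    have h12 : x ^ 12 = 1 := hf (by
      rw [map_pow, map_one]
      exact hK.pow_twelve_eq_one (pow_ne_zero k three_ne_zero) (by rw [← map_pow, hk, map_one])
        (hdet x))
    obtain ⟨j, hj, hj'⟩ := (Nat.dvd_prime_pow Nat.prime_three).1 (orderOf_dvd_of_pow_eq_one hk)
    have h12' := orderOf_dvd_of_pow_eq_one h12
    rw [hj'] at h12'
    have : j ≤ 1 := by
      by_contra hcon
      have := (pow_dvd_pow 3 (by omega : 2 ≤ j)).trans h12'
      norm_num at this
    exact orderOf_dvd_iff_pow_eq_one.1 (by rw [hj']; simpa using pow_dvd_pow 3 this)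
  have htr : ∀ x : P, (f x).trace = -1 ∨ x = 1 := by
    intro x
    have hx : f x ^ 3 = 1 := by rw [← map_pow, hcube, map_one]
    have hsq := Matrix.sq_fin_two (f x)
    rw [hdet, one_smul] at hsq
    have h3 := congrArg Matrix.trace hx
    rw [pow_succ, hsq, sub_mul, smul_mul_assoc, ← pow_two, hsq, one_mul] at h3
    simp only [Matrix.trace_sub, Matrix.trace_smul, Matrix.trace_one, smul_eq_mul,
      Fintype.card_fin, Nat.cast_ofNat] at h3
    -- The trace t of a matrix with cube 1 and determinant 1 satisfies t³ - 3t - 2 = 0.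
    have hprod : ((f x).trace - 2) * ((f x).trace + 1) ^ 2 = 0 := by linear_combination h3
    rcases mul_eq_zero.1 hprod with h | h
    · refine Or.inr (hf ?_)
      rw [map_one]
      exact Matrix.eq_one_of_pow_eq_one_of_trace_eq_two three_ne_zero hx (hdet x) (sub_eq_zero.1 h)
    · exact Or.inl (eq_neg_of_add_eq_zero_left (pow_eq_zero_iff two_ne_zero |>.1 h))
  by_cases hex : ∃ z : P, z ≠ 1
  · obtain ⟨z, hz⟩ := hex
    have hzt := (htr z).resolve_right hz
    have hz2 := Matrix.sq_fin_two (f z)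
    rw [hdet, hzt, one_smul, neg_smul, one_smul] at hz2
    -- Since 1 + f z + (f z)² = 0, the traces at x, xz, xz² sum to zero, so they cannot all be -1.
    have hall : ∀ x : P, x = 1 ∨ x * z = 1 ∨ x * z ^ 2 = 1 := by
      intro x
      have hsum : (f x).trace + (f (x * z)).trace + (f (x * z ^ 2)).trace = 0 := by
        rw [map_mul, map_mul, map_pow, hz2, ← Matrix.trace_add, ← Matrix.trace_add,
          show f x + f x * f z + f x * (-f z - 1) = 0 by noncomm_ring, Matrix.trace_zero]
      by_contra! hcon
      rw [(htr x).resolve_right hcon.1, (htr _).resolve_right hcon.2.1,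
        (htr _).resolve_right hcon.2.2] at hsum
      norm_num at hsum
    have hsub : (Set.univ : Set P) ⊆ {1, z⁻¹, (z ^ 2)⁻¹} := by
      intro x _
      rcases hall x with h | h | h
      · simp [h]
      · simp [eq_inv_of_mul_eq_one_left h]
      · simp [eq_inv_of_mul_eq_one_left h]
    rw [← Set.ncard_univ]
    refine (Set.ncard_le_ncard hsub (Set.toFinite _)).trans ?_
    refine (Set.ncard_insert_le _ _).trans ?_
    have := Set.ncard_insert_le z⁻¹ {(z ^ 2)⁻¹}
    rw [Set.ncard_singleton] at this
    omega
  · push Not at hex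
    have : Subsingleton P := ⟨fun x y => by rw [hex x, hex y]⟩
    rw [Nat.card_of_subsingleton (1 : P)]; norm_num

theorem IsImaginaryQuadratic.finite_subgroup {K : Type*} [Field K] [NumberField K]
    (hK : IsImaginaryQuadratic K) (H : Subgroup (GL (Fin 2) K)) [Finite H] :
    Group.IsSolvable H ∧ ∃ a b : ℕ, Nat.card H = 2 ^ a * 3 ^ b := by
  have hexp : ∀ x : H, x ^ 144 = 1 := by
    intro x
    have := hK.matrix_pow_eq_one (A := ((x : GL (Fin 2) K) : Matrix (Fin 2) (Fin 2) K))
      (n := Nat.card H) Nat.card_pos.ne' (by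
        rw [← Units.val_pow_eq_pow_val, ← Subgroup.coe_pow, pow_card_eq_one']; rfl)
    apply Subtype.ext; apply Units.ext
    simpa using this
  have hprime : ∀ p, p.Prime → p ∣ Nat.card H → p = 2 ∨ p = 3 := by
    intro p hp hd
    have := Fact.mk hp
    obtain ⟨x, hx⟩ := exists_prime_orderOf_dvd_card' p hd
    have h := orderOf_dvd_of_pow_eq_one (hexp x)
    rw [hx, show 144 = 2 ^ 4 * 3 ^ 2 from rfl, hp.dvd_mul] at h
    rcases h with h | h
    · exact Or.inl ((Nat.prime_dvd_prime_iff_eq hp Nat.prime_two).1 (hp.dvd_of_dvd_pow h))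
    · exact Or.inr ((Nat.prime_dvd_prime_iff_eq hp Nat.prime_three).1 (hp.dvd_of_dvd_pow h))
  refine ⟨?_, Nat.exists_eq_two_pow_mul_three_pow Nat.card_pos.ne' hprime⟩
  -- The image of the determinant is abelian, so solvability reduces to the kernel, which lies in
  -- SL₂.
  let det : H →* Kˣ := Matrix.GeneralLinearGroup.det.comp H.subtype
  obtain ⟨a, b, hab⟩ := Nat.exists_eq_two_pow_mul_three_pow (n := Nat.card det.ker)
    Nat.card_pos.ne' fun p hp hd => hprime p hp (hd.trans (Subgroup.card_subgroup_dvd_card _))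
  have : Group.IsSolvable det.ker := by
    refine Group.isSolvable_of_card_subgroup_le_three hab fun P hP => ?_
    refine hK.card_le_three hP
      ((Units.coeHom _).comp (H.subtype.comp (det.ker.subtype.comp P.subtype))) ?_ ?_
    · intro x y hxy
      exact Subtype.ext (Subtype.ext (Subtype.ext (Units.ext hxy)))
    · intro x
      exact congrArg Units.val (MonoidHom.mem_ker.1 (x : det.ker).2)
  exact Group.isSolvable_of_ker_le_range det.ker.subtype det (by simp)

/-! ### Identification of the field -/

/-- An imaginary quadratic field containing a square root of `-d` is isomorphic to `ℚ(√-d)`. -/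
theorem IsImaginaryQuadratic.nonempty_ringEquiv {K : Type*} [Field K] [NumberField K]
    (hK : IsImaginaryQuadratic K) {x : K} {d : ℕ} (hd : 0 < d) (hx : x ^ 2 = -(d : K)) :
    Nonempty (K ≃+* RatSqrtNeg d) := by
  have : IsSimpleOrder (IntermediateField ℚ K) :=
    IntermediateField.isSimpleOrder_of_finrank_prime ℚ K (by rw [hK.1]; exact Nat.prime_two)
  let σ : K →ₐ[ℚ] ℂ := IsAlgClosed.lift
  have htop : IntermediateField.adjoin ℚ {x} = ⊤ := by
    refine (eq_bot_or_eq_top _).resolve_left fun h => ?_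
    obtain ⟨q, hq⟩ := IntermediateField.mem_bot.1 (IntermediateField.adjoin_simple_eq_bot_iff.1 h)
    rw [← hq, ← map_pow, ← map_natCast (algebraMap ℚ K), ← map_neg] at hx
    have h1 := (algebraMap ℚ K).injective hx
    have h2 : (0 : ℚ) < d := by exact_mod_cast hd
    nlinarith [sq_nonneg q]
  have hrange : σ.fieldRange = IntermediateField.adjoin ℚ {σ x} := by
    rw [AlgHom.fieldRange_eq_map, ← htop, IntermediateField.adjoin_map, Set.image_singleton]
  have hsq : (((Real.sqrt (d : ℝ) : ℝ) : ℂ) * Complex.I) ^ 2 = (σ x) ^ 2 := by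
    rw [← map_pow, hx, mul_pow, ← Complex.ofReal_pow, Real.sq_sqrt (Nat.cast_nonneg d)]
    simp
  have heq : σ.fieldRange = RatSqrtNeg d := by
    rw [hrange, RatSqrtNeg]
    rcases sq_eq_sq_iff_eq_or_eq_neg.1 hsq with h | h
    · rw [h]
    · rw [h]
      apply le_antisymm
      · rw [IntermediateField.adjoin_simple_le_iff, ← neg_mem_iff]
        exact IntermediateField.mem_adjoin_simple_self ℚ _
      · rw [IntermediateField.adjoin_simple_le_iff, neg_mem_iff]
        exact IntermediateField.mem_adjoin_simple_self ℚ _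
  exact ⟨((AlgEquiv.ofInjectiveField σ).trans (IntermediateField.equivOfEq heq)).toRingEquiv⟩

/-- If a matrix of finite order over an imaginary quadratic field `K` has irrational trace, then `K`
contains a square root of `-1`, `-2` or `-3`. -/
theorem IsImaginaryQuadratic.exists_sq_eq_neg {K : Type*} [Field K] [NumberField K]
    (hK : IsImaginaryQuadratic K) {A : Matrix (Fin 2) (Fin 2) K} {n : ℕ} (hn : n ≠ 0)
    (hA : A ^ n = 1) (htr : ∀ q : ℚ, A.trace ≠ q) :
    ∃ (d : ℕ) (x : K), (d = 1 ∨ d = 2 ∨ d = 3) ∧ x ^ 2 = -(d : K) := by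
  have hdetn : A.det ^ n = 1 := by rw [← Matrix.det_pow, hA, Matrix.det_one]
  obtain ⟨m, hm, h1, h2⟩ := hK.exists_int_of_pow_eq_one hn hdetn
  obtain rfl | rfl | rfl | rfl | rfl : m = -2 ∨ m = -1 ∨ m = 0 ∨ m = 1 ∨ m = 2 := by omega
  all_goals push_cast at hm
  · have hdet : A.det = -1 := by
      have : (A.det + 1) ^ 2 = 0 := by linear_combination hm
      exact eq_neg_of_add_eq_zero_left (pow_eq_zero_iff two_ne_zero |>.1 this)
    obtain ⟨k, hk, hk1, hk2⟩ := hK.exists_int_trace (A := A ^ 2) hn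
      (by rw [← pow_mul, mul_comm, pow_mul, hA, one_pow]) (by rw [Matrix.det_pow, hdet]; norm_num)
    rw [Matrix.sq_fin_two, hdet, Matrix.trace_sub, Matrix.trace_smul, Matrix.trace_smul,
      Matrix.trace_one] at hk
    simp only [smul_eq_mul, Fintype.card_fin, Nat.cast_ofNat] at hk
    -- As the determinant is -1, k = tr(A²) = (tr A)² + 2, so (tr A)² = k - 2; k = 2 would give the
    -- rational trace 0.
    obtain rfl | rfl | rfl | rfl | rfl : k = -2 ∨ k = -1 ∨ k = 0 ∨ k = 1 ∨ k = 2 := by omega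
    all_goals push_cast at hk
    · refine ⟨1, A.trace / 2, by simp, ?_⟩
      push_cast
      linear_combination hk / 4
    · refine ⟨3, A.trace, by simp, ?_⟩
      push_cast
      linear_combination hk
    · refine ⟨2, A.trace, by simp, ?_⟩
      push_cast
      linear_combination hk
    · refine ⟨1, A.trace, by simp, ?_⟩
      push_cast
      linear_combination hk
    · refine absurd ?_ (htr 0)
      have : A.trace ^ 2 = 0 := by linear_combination hk
      simpa using this
  -- The determinant is a primitive cube root of unity; completing the square gives √-3.
  · refine ⟨3, 2 * A.det + 1, by simp, ?_⟩
    push_cast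
    linear_combination 4 * hm
  · refine ⟨1, A.det, by simp, ?_⟩
    push_cast
    linear_combination hm
  · refine ⟨3, 2 * A.det - 1, by simp, ?_⟩
    push_cast
    linear_combination 4 * hm
  · have hdet : A.det = 1 := by
      have : (A.det - 1) ^ 2 = 0 := by linear_combination hm
      exact sub_eq_zero.1 (pow_eq_zero_iff two_ne_zero |>.1 this)
    obtain ⟨k, hk, -⟩ := hK.exists_int_trace hn hA hdet
    exact absurd (by rw [hk]; simp) (htr k)

/-! ### Passage from the group algebra to the component -/

/-- The projection of a ring onto the corner of a central idempotent. -/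
def IsIdempotentElem.toCorner {R : Type*} [Ring R] {e : R} (he : IsIdempotentElem e)
    (hc : e ∈ Subring.center R) : R →+* he.Corner where
  toFun x := ⟨e * x * e, x, rfl⟩
  map_one' := Subtype.ext (by change e * 1 * e = e; rw [mul_one, he])
  map_zero' := Subtype.ext (by change e * 0 * e = 0; simp)
  map_add' x y := Subtype.ext (by change e * (x + y) * e = e * x * e + e * y * e; noncomm_ring)
  map_mul' x y := Subtype.ext (by
    have hx := Subring.mem_center_iff.1 hc x
    change e * (x * y) * e = (e * x * e) * (e * y * e)
    calc e * (x * y) * e = (e * x) * y * e := by noncomm_ring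
      _ = (x * (e * e)) * y * e := by rw [← hx, he]
      _ = ((x * e) * e) * y * e := by noncomm_ring
      _ = ((e * x * (e * e)) * y) * e := by rw [hx, he]
      _ = (e * x * e) * (e * y * e) := by noncomm_ring)

theorem IsIdempotentElem.toCorner_surjective {R : Type*} [Ring R] {e : R} (he : IsIdempotentElem e)
    (hc : e ∈ Subring.center R) : Function.Surjective (he.toCorner hc) := by
  rintro ⟨_, x, rfl⟩
  exact ⟨x, rfl⟩

/-- If the group algebra of a finite group maps onto `M₂(K)` with `K` imaginary quadratic, then `K`
contains a square root of `-1`, `-2` or `-3`. -/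
theorem IsImaginaryQuadratic.exists_sq_eq_neg_of_surjective {K : Type*} [Field K] [NumberField K]
    (hK : IsImaginaryQuadratic K) {G : Type*} [Group G] [Finite G]
    (F : MonoidAlgebra ℚ G →+* Matrix (Fin 2) (Fin 2) K) (hF : Function.Surjective F) :
    ∃ (d : ℕ) (x : K), (d = 1 ∨ d = 2 ∨ d = 3) ∧ x ^ 2 = -(d : K) := by
  by_cases hex : ∃ g : G, ∀ q : ℚ, (F (MonoidAlgebra.single g 1)).trace ≠ q
  · obtain ⟨g, hg⟩ := hex
    refine hK.exists_sq_eq_neg (n := Nat.card G) Nat.card_pos.ne' ?_ hg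
    rw [← map_pow, MonoidAlgebra.single_pow, pow_card_eq_one', one_pow,
      ← MonoidAlgebra.one_def, map_one]
  · exfalso
    push Not at hex
    -- Ring homomorphisms between ℚ-algebras are ℚ-linear, so rational traces on G give rational
    -- traces everywhere.
    have hrat : ∀ x, ∃ q : ℚ, (F x).trace = q := by
      intro x
      induction x using MonoidAlgebra.induction_linear with
      | zero => exact ⟨0, by simp⟩
      | add x y hx hy =>
        obtain ⟨q, hq⟩ := hx
        obtain ⟨r, hr⟩ := hy
        exact ⟨q + r, by rw [map_add, Matrix.trace_add, hq, hr]; simp⟩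
      | single g r =>
        obtain ⟨q, hq⟩ := hex g
        refine ⟨r * q, ?_⟩
        have : MonoidAlgebra.single g r = r • MonoidAlgebra.single g (1 : ℚ) := by simp
        rw [this, map_rat_smul, Matrix.trace_smul, hq, Rat.smul_def]
        push_cast; rfl
    -- Every t in K is the trace of a matrix in the image, forcing K = ℚ against degree two.
    have hbot : (⊥ : Subalgebra ℚ K) = ⊤ := by
      refine eq_top_iff.2 fun t _ => ?_
      obtain ⟨x, hx⟩ := hF !![t, 0; 0, 0]
      obtain ⟨q, hq⟩ := hrat x
      rw [hx, Matrix.trace_fin_two] at hq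
      exact Algebra.mem_bot.2 ⟨q, by simpa using hq.symm⟩
    have := hK.1
    rw [Subalgebra.bot_eq_top_iff_finrank_eq_one.1 hbot] at this
    norm_num at this

theorem theorem3p1 :
    (∀ (G : Type*) [Group G] [Finite G] (e : MonoidAlgebra ℚ G)
        (he : IsPrimitiveCentralIdempotent e) (K : Type*) [Field K] [NumberField K],
        IsImaginaryQuadratic K →
        Nonempty (SimpleComponent he ≃+* Matrix (Fin 2) (Fin 2) K) →
        ∃ d : ℕ, (d = 1 ∨ d = 2 ∨ d = 3) ∧
          Nonempty (K ≃+* RatSqrtNeg d) ∧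
          Nonempty (SimpleComponent he ≃+* Matrix (Fin 2) (Fin 2) (RatSqrtNeg d))) ∧
    (∀ (K : Type*) [Field K] [NumberField K], IsImaginaryQuadratic K →
        ∀ H : Subgroup (GL (Fin 2) K), Finite H →
          Group.IsSolvable H ∧ ∃ a b : ℕ, Nat.card H = 2 ^ a * 3 ^ b) := by
  refine ⟨?_, fun K _ _ hK H _ => hK.finite_subgroup H⟩
  intro G _ _ e he K _ _ hK ⟨φ⟩
  obtain ⟨d, x, hd, hx⟩ := hK.exists_sq_eq_neg_of_surjective
    ((φ : SimpleComponent he →+* Matrix (Fin 2) (Fin 2) K).comp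
      (he.isIdempotentElem.toCorner he.mem_center))
    (φ.surjective.comp (he.isIdempotentElem.toCorner_surjective he.mem_center))
  obtain ⟨ψ⟩ := hK.nonempty_ringEquiv (by omega) hx
  exact ⟨d, hd, ⟨ψ⟩, ⟨φ.trans ψ.mapMatrix⟩⟩
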